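/- Let $(\Omega,\mathcal F,P)$ be a probability space with a filtration $(\mathcal F_t)_{t\ge 0}$, let $W^X$ be a standard real Brownian motion with respect to $(\mathcal F_t)$, let $T\ge 0$, and let $h\colon[0,T]\to\mathbb R$ be a deterministic measurable function with $\int_0^T h^2(u)\,du<\infty$ (for instance a piecewise constant function). Let $X=(X(t))_{t\in[0,T]}$ be the Itô process with almost surely continuous paths given by $$dX(t)=h(t)\,dW^X(t),\quad t\in(0,T],\qquad X(0)=0,$$ that is, $X(t)=\int_0^t h(u)\,dW^X(u)$ almost surely for every $t\in[0,T]$, the right-hand side being an Itô integral. Then, almost surely, the path of $X$ is integrable over $[0,T]$; the random variable $\int_0^T X(t)\,dt$ is square integrable; and $$\operatorname{Var}\Bigl[\int_0^T X(t)\,dt\Bigr]=\int_0^T\int_0^s\Bigl(\int_0^t h^2(u)\,du\Bigr)dt\,ds+\int_0^T(T-s)\Bigl(\int_0^s h^2(t)\,dt\Bigr)ds.$$ -/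

import Mathlib

open MeasureTheory ProbabilityTheory Filter Topology
open scoped NNReal ENNReal

noncomputable section

namespace ItoVar

variable {Ω : Type*} {mΩ : MeasurableSpace Ω}

/-- `W` is a (standard real) Brownian motion relative to the filtration `𝓕`: it is a Brownian
motion, it is adapted, and its increments after time `s` are independent of `𝓕 s`. No completeness
or right-continuity of `𝓕` is required, so the natural filtration of `W` is allowed. -/
structure IsBrownianMotion (W : ℝ≥0 → Ω → ℝ) (𝓕 : Filtration ℝ≥0 mΩ) (P : Measure Ω) : Prop where
  isBrownian : IsBrownianReal W P
  adapted : ∀ t, Measurable[𝓕 t] (W t)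
  indep_increments : ∀ s t, s ≤ t →
    Indep (MeasurableSpace.comap (fun ω ↦ W t ω - W s ω) inferInstance) (𝓕 s) P

/-- A simple (elementary predictable) process `∑ i, ξ i * 1_{(a i, b i]}`, where `ξ i` is bounded
and `𝓕 (a i)`-measurable. The intervals may overlap: passing to a common refinement shows that
these are the same processes as those written along one partition. -/
structure SimpleProcess (𝓕 : Filtration ℝ≥0 mΩ) where
  n : ℕ
  a : Fin n → ℝ≥0
  b : Fin n → ℝ≥0
  a_le_b : ∀ i, a i ≤ b i
  ξ : Fin n → Ω → ℝ
  measurable_ξ : ∀ i, Measurable[𝓕 (a i)] (ξ i)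
  bounded_ξ : ∃ C : ℝ, ∀ i ω, |ξ i ω| ≤ C

/-- The value of a simple process at time `u`. -/
def SimpleProcess.eval {𝓕 : Filtration ℝ≥0 mΩ} (H : SimpleProcess 𝓕) (u : ℝ) (ω : Ω) : ℝ :=
  ∑ i, (Set.Ioc (H.a i : ℝ) (H.b i : ℝ)).indicator (fun _ ↦ H.ξ i ω) u

/-- The elementary stochastic integral `∫_0^t H dW` of a simple process. -/
def SimpleProcess.integral {𝓕 : Filtration ℝ≥0 mΩ} (H : SimpleProcess 𝓕) (W : ℝ≥0 → Ω → ℝ)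
    (t : ℝ≥0) (ω : Ω) : ℝ :=
  ∑ i, H.ξ i ω * (W (min (H.b i) t) ω - W (min (H.a i) t) ω)

/-- The random variable `Y` is (a version of) the Itô integral `∫_0^t H(u) dW(u)` of the
square-integrable process `H`: simple processes `S n` converge to `H` in `L²([0,t] × Ω)`, and their
elementary integrals converge to `Y` in `L²(Ω)`. -/
def IsItoIntegral (W : ℝ≥0 → Ω → ℝ) (𝓕 : Filtration ℝ≥0 mΩ) (P : Measure Ω) (t : ℝ≥0)
    (H : ℝ → Ω → ℝ) (Y : Ω → ℝ) : Prop :=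
  MemLp (fun p : ℝ × Ω ↦ H p.1 p.2) 2 ((volume.restrict (Set.Ioc 0 (t : ℝ))).prod P) ∧
  MemLp Y 2 P ∧
  ∃ S : ℕ → SimpleProcess 𝓕,
    Tendsto (fun n ↦ eLpNorm (fun p : ℝ × Ω ↦ (S n).eval p.1 p.2 - H p.1 p.2) 2
      ((volume.restrict (Set.Ioc 0 (t : ℝ))).prod P)) atTop (𝓝 0) ∧
    Tendsto (fun n ↦ eLpNorm (fun ω ↦ (S n).integral W t ω - Y ω) 2 P) atTop (𝓝 0)

/-- `X` is an Itô process on `[0,T]` with `dX(t) = h(t) dW(t)` and `X(0) = 0`, for a deterministic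
volatility coefficient `h`: almost surely it starts at `0` and has continuous paths, and
`X(t) - X(0) = ∫_0^t h(u) dW(u)` almost surely for every `t ∈ [0,T]`. -/
structure IsItoProcess (W : ℝ≥0 → Ω → ℝ) (𝓕 : Filtration ℝ≥0 mΩ) (P : Measure Ω) (T : ℝ≥0)
    (h : ℝ → ℝ) (X : ℝ≥0 → Ω → ℝ) : Prop where
  start_zero : ∀ᵐ ω ∂P, X 0 ω = 0
  continuous_paths : ∀ᵐ ω ∂P, ContinuousOn (fun t ↦ X t ω) (Set.Icc 0 T)
  eq_integral : ∀ t ≤ T, IsItoIntegral W 𝓕 P t (fun u _ ↦ h u) (fun ω ↦ X t ω - X 0 ω)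

end ItoVar

end

/-! The process is centered, so the variance of its time integral is a second moment, and Fubini
turns that into the double integral over [0,T]² of the covariance E[X(s)X(t)]. By the polarized Itô
isometry with two horizons (`IsItoIntegral.integral_mul`) this covariance is G(min(s,t)), where G(r)
is the integral of h² over [0,r]. Cutting the inner integral at t = s leaves the integral of G over
[0,s] plus (T-s)G(s), which are the two terms of the formula.

The isometry is proved from the L² definition: for simple processes, bilinearity reduces it to two
terms ξ·(increment), where independence of the past leaves only the overlap of the intervals;
continuity of the L² pairing then passes to the limit. Fubini needs joint measurability of X, which
comes from almost sure path continuity. -/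

namespace ItoVar

/-! ### Moments of Brownian increments -/

section IncrementMoments

variable {Ω : Type*} {mΩ : MeasurableSpace Ω} {P : Measure Ω} {𝓕 : Filtration ℝ≥0 mΩ}
  {W : ℝ≥0 → Ω → ℝ}

namespace IsBrownianMotion

lemma isPreBrownianReal (hW : IsBrownianMotion W 𝓕 P) : IsPreBrownianReal W P :=
  hW.isBrownian.toIsPreBrownianReal

lemma measurable (hW : IsBrownianMotion W 𝓕 P) (t : ℝ≥0) : Measurable (W t) :=
  (hW.adapted t).mono (𝓕.le t) le_rfl

lemma measurable_of_le (hW : IsBrownianMotion W 𝓕 P) {s t : ℝ≥0} (hst : s ≤ t) :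
    Measurable[𝓕 t] (W s) :=
  (hW.adapted s).mono (𝓕.mono hst) le_rfl

lemma memLp_sub (hW : IsBrownianMotion W 𝓕 P) (s t : ℝ≥0) :
    MemLp (fun ω ↦ W t ω - W s ω) 2 P :=
  (hW.isPreBrownianReal.isGaussianProcess.hasGaussianLaw_eval t).memLp_two.sub
    (hW.isPreBrownianReal.isGaussianProcess.hasGaussianLaw_eval s).memLp_two

lemma integral_sub_eq_zero (hW : IsBrownianMotion W 𝓕 P) (s t : ℝ≥0) :
    ∫ ω, (W t ω - W s ω) ∂P = 0 := by
  rw [integral_sub (hW.isPreBrownianReal.integrable_eval t)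
    (hW.isPreBrownianReal.integrable_eval s), hW.isPreBrownianReal.integral_eval,
    hW.isPreBrownianReal.integral_eval, sub_zero]

lemma integral_sub_sq (hW : IsBrownianMotion W 𝓕 P) {s t : ℝ≥0} (hst : s ≤ t) :
    ∫ ω, (W t ω - W s ω) ^ 2 ∂P = t - s := by
  have h := (hW.isPreBrownianReal.hasLaw_sub t s).variance_eq
  rw [variance_id_gaussianReal, variance_of_integral_eq_zero
    (((hW.measurable t).sub (hW.measurable s)).aemeasurable)
    (by simpa using hW.integral_sub_eq_zero s t)] at h
  simp only [Pi.sub_apply, coe_nndist] at h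
  rw [h]
  exact abs_of_nonneg (sub_nonneg.2 (NNReal.coe_le_coe.2 hst))

lemma indepFun (hW : IsBrownianMotion W 𝓕 P) {s t : ℝ≥0} (hst : s ≤ t) {Z : Ω → ℝ}
    (hZ : Measurable[𝓕 s] Z) : IndepFun Z (fun ω ↦ W t ω - W s ω) P := by
  rw [IndepFun_iff_Indep]
  exact (indep_of_indep_of_le_right (hW.indep_increments s t hst) hZ.comap_le).symm

/-- A Brownian increment is orthogonal to the past. -/
lemma integral_mul_sub (hW : IsBrownianMotion W 𝓕 P) {s t : ℝ≥0} (hst : s ≤ t) {Z : Ω → ℝ}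
    (hZ : Measurable[𝓕 s] Z) : ∫ ω, Z ω * (W t ω - W s ω) ∂P = 0 := by
  rw [(hW.indepFun hst hZ).integral_fun_mul_eq_mul_integral
    (hZ.mono (𝓕.le s) le_rfl).aestronglyMeasurable (hW.memLp_sub s t).aestronglyMeasurable,
    hW.integral_sub_eq_zero, mul_zero]

lemma integral_mul_sub_sq (hW : IsBrownianMotion W 𝓕 P) {s t : ℝ≥0} (hst : s ≤ t) {Z : Ω → ℝ}
    (hZ : Measurable[𝓕 s] Z) :
    ∫ ω, Z ω * (W t ω - W s ω) ^ 2 ∂P = (∫ ω, Z ω ∂P) * (t - s) := by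
  have h : IndepFun Z (fun ω ↦ (W t ω - W s ω) ^ 2) P :=
    (hW.indepFun hst hZ).comp (φ := id) (ψ := fun x ↦ x ^ 2) measurable_id (by fun_prop)
  rw [h.integral_fun_mul_eq_mul_integral (hZ.mono (𝓕.le s) le_rfl).aestronglyMeasurable
    (((hW.measurable t).sub (hW.measurable s)).pow_const 2).aestronglyMeasurable,
    hW.integral_sub_sq hst]

lemma memLp_mul_sub (hW : IsBrownianMotion W 𝓕 P) (s t : ℝ≥0) {ξ : Ω → ℝ}
    (hξ : Measurable ξ) {C : ℝ} (hC : ∀ ω, |ξ ω| ≤ C) :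
    MemLp (fun ω ↦ ξ ω * (W t ω - W s ω)) 2 P := by
  refine (hW.memLp_sub s t).of_le_mul (c := C)
    (hξ.mul ((hW.measurable t).sub (hW.measurable s))).aestronglyMeasurable
    (Eventually.of_forall fun ω ↦ ?_)
  rw [norm_mul]
  exact mul_le_mul_of_nonneg_right (hC ω) (norm_nonneg _)

/-- Cut both intervals at c and at m = min b d. In a product of increments over disjoint intervals
the later one is centered and independent of all other factors, so only the square over the overlap
(c, m] survives. -/
lemma integral_mul_sub_mul_sub_of_le (hW : IsBrownianMotion W 𝓕 P) {a b c d : ℝ≥0}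
    (hcd : c ≤ d) (hac : a ≤ c) {ξ η : Ω → ℝ} (hξ : Measurable[𝓕 a] ξ)
    (hη : Measurable[𝓕 c] η) {C D : ℝ} (hC : ∀ ω, |ξ ω| ≤ C) (hD : ∀ ω, |η ω| ≤ D) :
    ∫ ω, (ξ ω * (W b ω - W a ω)) * (η ω * (W d ω - W c ω)) ∂P =
      max ((min b d : ℝ≥0) - (max a c : ℝ≥0) : ℝ) 0 * ∫ ω, ξ ω * η ω ∂P := by
  rw [max_eq_right hac]
  rcases le_total b c with hbc | hcb
  · have hle : ((min b d : ℝ≥0) : ℝ) ≤ c := by exact_mod_cast (min_le_left b d).trans hbc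
    rw [max_eq_right (sub_nonpos.2 hle), zero_mul]
    have hZ : Measurable[𝓕 c] (fun ω ↦ (ξ ω * (W b ω - W a ω)) * η ω) :=
      ((hξ.mono (𝓕.mono hac) le_rfl).mul
        ((hW.measurable_of_le hbc).sub (hW.measurable_of_le hac))).mul hη
    rw [← hW.integral_mul_sub hcd hZ]
    simp only [mul_assoc]
  · set m := min b d with hm
    have hcm : c ≤ m := le_min hcb hcd
    have hmb : m ≤ b := min_le_left _ _
    have hmd : m ≤ d := min_le_right _ _
    have hcm' : (c : ℝ) ≤ m := by exact_mod_cast hcm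
    rw [max_eq_left (sub_nonneg.2 hcm')]
    have mξ := hξ.mono (𝓕.le a) le_rfl
    have mη := hη.mono (𝓕.le c) le_rfl
    have hξc : Measurable[𝓕 c] ξ := hξ.mono (𝓕.mono hac) le_rfl
    have hξη : Measurable[𝓕 c] (fun ω ↦ ξ ω * η ω) := hξc.mul hη
    have hξηm : Measurable[𝓕 m] (fun ω ↦ ξ ω * η ω) := hξη.mono (𝓕.mono hcm) le_rfl
    have i (p q r s : ℝ≥0) :
        Integrable (fun ω ↦ (ξ ω * (W q ω - W p ω)) * (η ω * (W s ω - W r ω))) P :=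
      (hW.memLp_mul_sub p q mξ hC).integrable_mul (hW.memLp_mul_sub r s mη hD)
    have h1 : ∫ ω, (ξ ω * (W m ω - W c ω)) * (η ω * (W m ω - W c ω)) ∂P =
        (m - c) * ∫ ω, ξ ω * η ω ∂P := by
      rw [mul_comm, ← hW.integral_mul_sub_sq hcm hξη]
      exact integral_congr_ae (Eventually.of_forall fun ω ↦ by ring)
    have h2 : ∫ ω, (ξ ω * (W c ω - W a ω)) * (η ω * (W m ω - W c ω)) ∂P = 0 := by
      rw [← hW.integral_mul_sub hcm
        (hξη.mul ((hW.measurable_of_le le_rfl).sub (hW.measurable_of_le hac)))]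
      exact integral_congr_ae (Eventually.of_forall fun ω ↦ by simp; ring)
    have h3 : ∫ ω, (ξ ω * (W m ω - W a ω)) * (η ω * (W d ω - W m ω)) ∂P = 0 := by
      rw [← hW.integral_mul_sub hmd (hξηm.mul
        ((hW.measurable_of_le le_rfl).sub (hW.measurable_of_le (hac.trans hcm))))]
      exact integral_congr_ae (Eventually.of_forall fun ω ↦ by simp; ring)
    have h4 : ∫ ω, (ξ ω * (W b ω - W m ω)) * (η ω * (W m ω - W c ω)) ∂P = 0 := by
      rw [← hW.integral_mul_sub hmb (hξηm.mul
        ((hW.measurable_of_le le_rfl).sub (hW.measurable_of_le hcm)))]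
      exact integral_congr_ae (Eventually.of_forall fun ω ↦ by simp; ring)
    -- The absent cross term (W b - W m)(W d - W m) is zero, since m is b or d.
    have hdec : ∀ ω, (ξ ω * (W b ω - W a ω)) * (η ω * (W d ω - W c ω)) =
        (ξ ω * (W m ω - W c ω)) * (η ω * (W m ω - W c ω)) +
        (ξ ω * (W c ω - W a ω)) * (η ω * (W m ω - W c ω)) +
        (ξ ω * (W m ω - W a ω)) * (η ω * (W d ω - W m ω)) +
        (ξ ω * (W b ω - W m ω)) * (η ω * (W m ω - W c ω)) := by
      intro ω
      rcases min_choice b d with h | h <;> rw [hm, h] <;> ring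
    simp_rw [hdec]
    rw [integral_add, integral_add, integral_add, h1, h2, h3, h4]
    · ring
    · exact i _ _ _ _
    · exact i _ _ _ _
    · exact (i _ _ _ _).add (i _ _ _ _)
    · exact i _ _ _ _
    · exact ((i _ _ _ _).add (i _ _ _ _)).add (i _ _ _ _)
    · exact i _ _ _ _

/-- The product moment of two elementary stochastic integrals. -/
lemma integral_mul_sub_mul_sub (hW : IsBrownianMotion W 𝓕 P) {a b c d : ℝ≥0}
    (hab : a ≤ b) (hcd : c ≤ d) {ξ η : Ω → ℝ} (hξ : Measurable[𝓕 a] ξ)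
    (hη : Measurable[𝓕 c] η) {C D : ℝ} (hC : ∀ ω, |ξ ω| ≤ C) (hD : ∀ ω, |η ω| ≤ D) :
    ∫ ω, (ξ ω * (W b ω - W a ω)) * (η ω * (W d ω - W c ω)) ∂P =
      max ((min b d : ℝ≥0) - (max a c : ℝ≥0) : ℝ) 0 * ∫ ω, ξ ω * η ω ∂P := by
  rcases le_total a c with hac | hca
  · exact hW.integral_mul_sub_mul_sub_of_le hcd hac hξ hη hC hD
  · rw [min_comm b d, max_comm a c]
    simp_rw [fun ω ↦ mul_comm (ξ ω * (W b ω - W a ω)), fun ω ↦ mul_comm (ξ ω) (η ω)]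
    exact hW.integral_mul_sub_mul_sub_of_le hab hca hη hξ hD hC

/-- A horizon beyond the left endpoint leaves that endpoint, hence the measurability of the
coefficient, unchanged. A horizon before it makes the increment zero and the overlap empty. -/
lemma integral_mul_sub_min_mul_sub_min (hW : IsBrownianMotion W 𝓕 P) {a b c d : ℝ≥0} (s t : ℝ≥0)
    (hab : a ≤ b) (hcd : c ≤ d) {ξ η : Ω → ℝ} (hξ : Measurable[𝓕 a] ξ)
    (hη : Measurable[𝓕 c] η) {C D : ℝ} (hC : ∀ ω, |ξ ω| ≤ C) (hD : ∀ ω, |η ω| ≤ D) :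
    ∫ ω, (ξ ω * (W (min b s) ω - W (min a s) ω)) * (η ω * (W (min d t) ω - W (min c t) ω)) ∂P =
      max ((min (min b d) (min s t) : ℝ≥0) - (max a c : ℝ≥0) : ℝ) 0 * ∫ ω, ξ ω * η ω ∂P := by
  rcases le_total a s with has | hsa
  · rcases le_total c t with hct | htc
    · rw [min_eq_left has, min_eq_left hct, hW.integral_mul_sub_mul_sub (le_min hab has)
        (le_min hcd hct) hξ hη hC hD, min_min_min_comm]
    · rw [min_eq_right htc, min_eq_right (htc.trans hcd)]
      have : ((min (min b d) (min s t) : ℝ≥0) : ℝ) ≤ (max a c : ℝ≥0) := by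
        exact_mod_cast (min_le_right _ _).trans ((min_le_right _ _).trans
          (htc.trans (le_max_right _ _)))
      rw [max_eq_right (sub_nonpos.2 this)]
      simp
  · rw [min_eq_right hsa, min_eq_right (hsa.trans hab)]
    have : ((min (min b d) (min s t) : ℝ≥0) : ℝ) ≤ (max a c : ℝ≥0) := by
      exact_mod_cast (min_le_right _ _).trans ((min_le_left _ _).trans
        (hsa.trans (le_max_left _ _)))
    rw [max_eq_right (sub_nonpos.2 this)]
    simp

end IsBrownianMotion

end IncrementMoments

/-- The `L²` pairing is continuous. -/
lemma tendsto_integral_mul_of_tendsto_eLpNorm {α : Type*} {m : MeasurableSpace α} {μ : Measure α}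
    {f g : ℕ → α → ℝ} {F G : α → ℝ} (hf : ∀ n, MemLp (f n) 2 μ) (hg : ∀ n, MemLp (g n) 2 μ)
    (hF : MemLp F 2 μ) (hG : MemLp G 2 μ)
    (hfF : Tendsto (fun n ↦ eLpNorm (fun x ↦ f n x - F x) 2 μ) atTop (𝓝 0))
    (hgG : Tendsto (fun n ↦ eLpNorm (fun x ↦ g n x - G x) 2 μ) atTop (𝓝 0)) :
    Tendsto (fun n ↦ ∫ x, f n x * g n x ∂μ) atTop (𝓝 (∫ x, F x * G x ∂μ)) := by
  have key {u v : α → ℝ} (hu : MemLp u 2 μ) (hv : MemLp v 2 μ) :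
      ∫ x, u x * v x ∂μ = inner ℝ (hu.toLp u) (hv.toLp v) := by
    rw [L2.inner_def]
    refine integral_congr_ae ?_
    filter_upwards [hu.coeFn_toLp, hv.coeFn_toLp] with x h1 h2
    simp [h1, h2, mul_comm]
  simp_rw [fun n ↦ key (hf n) (hg n), key hF hG]
  exact ((Lp.tendsto_Lp_iff_tendsto_eLpNorm'' f hf F hF).2 hfF).inner
    ((Lp.tendsto_Lp_iff_tendsto_eLpNorm'' g hg G hG).2 hgG)

/-! ### Itô isometry -/

section Isometry

variable {Ω : Type*} {mΩ : MeasurableSpace Ω} {P : Measure Ω} {𝓕 : Filtration ℝ≥0 mΩ}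
  {W : ℝ≥0 → Ω → ℝ}

namespace SimpleProcess

lemma measurable_ξ' (H : SimpleProcess 𝓕) (i : Fin H.n) : Measurable (H.ξ i) :=
  (H.measurable_ξ i).mono (𝓕.le _) le_rfl

lemma memLp_integral (H : SimpleProcess 𝓕) (hW : IsBrownianMotion W 𝓕 P) (t : ℝ≥0) :
    MemLp (H.integral W t) 2 P := by
  obtain ⟨C, hC⟩ := H.bounded_ξ
  exact memLp_finsetSum _ fun i _ ↦ hW.memLp_mul_sub _ _ (H.measurable_ξ' i) (hC i)

lemma memLp_eval [IsFiniteMeasure P] (H : SimpleProcess 𝓕) (μ : Measure ℝ) [IsFiniteMeasure μ] :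
    MemLp (fun p : ℝ × Ω ↦ H.eval p.1 p.2) 2 (μ.prod P) := by
  obtain ⟨C, hC⟩ := H.bounded_ξ
  refine memLp_finsetSum _ fun i _ ↦ MemLp.of_bound (C := C) ?_ (Eventually.of_forall fun p ↦ ?_)
  · have : (fun p : ℝ × Ω ↦ (Set.Ioc (H.a i : ℝ) (H.b i : ℝ)).indicator (fun _ ↦ H.ξ i p.2) p.1) =
        (Prod.fst ⁻¹' Set.Ioc (H.a i : ℝ) (H.b i : ℝ)).indicator (fun p ↦ H.ξ i p.2) := by
      ext p; simp [Set.indicator]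
    rw [this]
    exact (((H.measurable_ξ' i).comp measurable_snd).indicator
      (measurable_fst measurableSet_Ioc)).aestronglyMeasurable
  · exact (norm_indicator_le_norm_self (fun _ ↦ H.ξ i p.2) p.1).trans (hC i p.2)

lemma integral_integral_eq_zero [IsFiniteMeasure P] (H : SimpleProcess 𝓕)
    (hW : IsBrownianMotion W 𝓕 P) (t : ℝ≥0) : ∫ ω, H.integral W t ω ∂P = 0 := by
  obtain ⟨C, hC⟩ := H.bounded_ξ
  unfold SimpleProcess.integral
  rw [integral_finsetSum _ fun i _ ↦
    (hW.memLp_mul_sub _ _ (H.measurable_ξ' i) (hC i)).integrable one_le_two]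
  refine Finset.sum_eq_zero fun i _ ↦ ?_
  rcases le_total (H.a i) t with h | h
  · rw [min_eq_left h]
    exact hW.integral_mul_sub (le_min (H.a_le_b i) h) (H.measurable_ξ i)
  · rw [min_eq_right h, min_eq_right (h.trans (H.a_le_b i))]
    simp

/-- With r = min s t the overlap length is the one in `integral_mul_sub_min_mul_sub_min`, so the
isometry for simple processes holds term by term. -/
lemma integral_indicator_mul_indicator [SFinite P] (a b c d r : ℝ≥0) (ξ η : Ω → ℝ) :
    ∫ p : ℝ × Ω, (Set.Ioc (a : ℝ) b).indicator (fun _ ↦ ξ p.2) p.1 *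
        (Set.Ioc (c : ℝ) d).indicator (fun _ ↦ η p.2) p.1
        ∂((volume.restrict (Set.Ioc 0 (r : ℝ))).prod P) =
      max ((min (min b d) r : ℝ≥0) - (max a c : ℝ≥0) : ℝ) 0 * ∫ ω, ξ ω * η ω ∂P := by
  have h : ∀ p : ℝ × Ω, (Set.Ioc (a : ℝ) b).indicator (fun _ ↦ ξ p.2) p.1 *
      (Set.Ioc (c : ℝ) d).indicator (fun _ ↦ η p.2) p.1 =
      (Set.Ioc (max a c : ℝ) (min b d)).indicator 1 p.1 * (ξ p.2 * η p.2) := by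
    intro p
    rw [← Set.Ioc_inter_Ioc]
    by_cases h1 : p.1 ∈ Set.Ioc (a : ℝ) b <;> by_cases h2 : p.1 ∈ Set.Ioc (c : ℝ) d <;>
      simp [h1, h2, -Set.mem_Ioc]
  simp_rw [h]
  rw [integral_prod_mul (fun u ↦ (Set.Ioc (max a c : ℝ) (min b d)).indicator 1 u)
    (fun ω ↦ ξ ω * η ω), integral_indicator_one measurableSet_Ioc,
    measureReal_restrict_apply measurableSet_Ioc, Set.Ioc_inter_Ioc, Real.volume_real_Ioc,
    max_eq_left (le_max_of_le_left a.coe_nonneg)]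
  push_cast
  rfl

/-- The Itô isometry for simple processes, in polarized form and with two time horizons. -/
lemma integral_integral_mul_integral [IsFiniteMeasure P] (H K : SimpleProcess 𝓕)
    (hW : IsBrownianMotion W 𝓕 P) (s t : ℝ≥0) :
    ∫ ω, H.integral W s ω * K.integral W t ω ∂P =
      ∫ p : ℝ × Ω, H.eval p.1 p.2 * K.eval p.1 p.2
        ∂((volume.restrict (Set.Ioc 0 ((min s t : ℝ≥0) : ℝ))).prod P) := by
  obtain ⟨C, hC⟩ := H.bounded_ξ
  obtain ⟨D, hD⟩ := K.bounded_ξ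
  have mem {L : SimpleProcess 𝓕} {E : ℝ} (hE : ∀ i ω, |L.ξ i ω| ≤ E) (i : Fin L.n) :
      MemLp (fun p : ℝ × Ω ↦ (Set.Ioc (L.a i : ℝ) (L.b i)).indicator (fun _ ↦ L.ξ i p.2) p.1) 2
        ((volume.restrict (Set.Ioc 0 ((min s t : ℝ≥0) : ℝ))).prod P) := by
    -- A single summand is itself a simple process with one interval.
    simpa [SimpleProcess.eval] using memLp_eval (P := P)
      ⟨1, fun _ ↦ L.a i, fun _ ↦ L.b i, fun _ ↦ L.a_le_b i, fun _ ↦ L.ξ i,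
        fun _ ↦ L.measurable_ξ i, E, fun _ ↦ hE i⟩
      (volume.restrict (Set.Ioc 0 ((min s t : ℝ≥0) : ℝ)))
  have hI (i : Fin H.n) (j : Fin K.n) : Integrable (fun ω ↦
      (H.ξ i ω * (W (min (H.b i) s) ω - W (min (H.a i) s) ω)) *
        (K.ξ j ω * (W (min (K.b j) t) ω - W (min (K.a j) t) ω))) P :=
    (hW.memLp_mul_sub _ _ (H.measurable_ξ' i) (hC i)).integrable_mul
      (hW.memLp_mul_sub _ _ (K.measurable_ξ' j) (hD j))
  have hJ (i : Fin H.n) (j : Fin K.n) : Integrable (fun p : ℝ × Ω ↦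
      (Set.Ioc (H.a i : ℝ) (H.b i)).indicator (fun _ ↦ H.ξ i p.2) p.1 *
        (Set.Ioc (K.a j : ℝ) (K.b j)).indicator (fun _ ↦ K.ξ j p.2) p.1)
      ((volume.restrict (Set.Ioc 0 ((min s t : ℝ≥0) : ℝ))).prod P) :=
    (mem hC i).integrable_mul (mem hD j)
  unfold SimpleProcess.integral SimpleProcess.eval
  simp_rw [Finset.sum_mul_sum]
  rw [integral_finsetSum _ fun i _ ↦ integrable_finsetSum _ fun j _ ↦ hI i j,
    integral_finsetSum _ fun i _ ↦ integrable_finsetSum _ fun j _ ↦ hJ i j]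
  refine Finset.sum_congr rfl fun i _ ↦ ?_
  rw [integral_finsetSum _ fun j _ ↦ hI i j, integral_finsetSum _ fun j _ ↦ hJ i j]
  refine Finset.sum_congr rfl fun j _ ↦ ?_
  rw [integral_indicator_mul_indicator, hW.integral_mul_sub_min_mul_sub_min s t (H.a_le_b i)
    (K.a_le_b j) (H.measurable_ξ i) (K.measurable_ξ j) (hC i) (hD j)]

end SimpleProcess

lemma tendsto_eLpNorm_of_measure_le {α : Type*} {m : MeasurableSpace α} {μ ν : Measure α}
    (hμν : μ ≤ ν) {f : ℕ → α → ℝ}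
    (hf : Tendsto (fun n ↦ eLpNorm (f n) 2 ν) atTop (𝓝 0)) :
    Tendsto (fun n ↦ eLpNorm (f n) 2 μ) atTop (𝓝 0) :=
  tendsto_of_tendsto_of_tendsto_of_le_of_le tendsto_const_nhds hf (fun _ ↦ zero_le)
    fun _ ↦ eLpNorm_mono_measure _ hμν

lemma restrict_Ioc_prod_mono [SFinite P] {r s : ℝ≥0} (hrs : r ≤ s) :
    (volume.restrict (Set.Ioc 0 (r : ℝ))).prod P ≤ (volume.restrict (Set.Ioc 0 (s : ℝ))).prod P :=
  Measure.prod_mono (Measure.restrict_mono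
    (Set.Ioc_subset_Ioc_right (NNReal.coe_le_coe.2 hrs)) le_rfl) le_rfl

/-- The Itô isometry in polarized form, with two time horizons. -/
lemma IsItoIntegral.integral_mul [IsFiniteMeasure P] (hW : IsBrownianMotion W 𝓕 P) {s t : ℝ≥0}
    {H K : ℝ → Ω → ℝ} {Y Z : Ω → ℝ} (hY : IsItoIntegral W 𝓕 P s H Y)
    (hZ : IsItoIntegral W 𝓕 P t K Z) :
    ∫ ω, Y ω * Z ω ∂P = ∫ p : ℝ × Ω, H p.1 p.2 * K p.1 p.2
        ∂((volume.restrict (Set.Ioc 0 ((min s t : ℝ≥0) : ℝ))).prod P) := by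
  obtain ⟨hH, hY2, S, hSH, hSY⟩ := hY
  obtain ⟨hK, hZ2, R, hRK, hRZ⟩ := hZ
  have h1 := tendsto_integral_mul_of_tendsto_eLpNorm (fun n ↦ (S n).memLp_integral hW s)
    (fun n ↦ (R n).memLp_integral hW t) hY2 hZ2 hSY hRZ
  have h2 := tendsto_integral_mul_of_tendsto_eLpNorm
    (fun n ↦ (S n).memLp_eval (P := P) (volume.restrict (Set.Ioc 0 ((min s t : ℝ≥0) : ℝ))))
    (fun n ↦ (R n).memLp_eval _) (hH.mono_measure (restrict_Ioc_prod_mono (min_le_left s t)))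
    (hK.mono_measure (restrict_Ioc_prod_mono (min_le_right s t)))
    (tendsto_eLpNorm_of_measure_le (restrict_Ioc_prod_mono (min_le_left s t)) hSH)
    (tendsto_eLpNorm_of_measure_le (restrict_Ioc_prod_mono (min_le_right s t)) hRK)
  simp_rw [SimpleProcess.integral_integral_mul_integral _ _ hW] at h1
  exact tendsto_nhds_unique h1 h2

/-- Itô integrals are centered. -/
lemma IsItoIntegral.integral_eq_zero [IsFiniteMeasure P] (hW : IsBrownianMotion W 𝓕 P) {t : ℝ≥0}
    {H : ℝ → Ω → ℝ} {Y : Ω → ℝ} (hY : IsItoIntegral W 𝓕 P t H Y) : ∫ ω, Y ω ∂P = 0 := by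
  obtain ⟨-, hY2, S, -, hSY⟩ := hY
  -- Pairing with the constant 1 carries the zero mean to the L² limit.
  have h1 := tendsto_integral_mul_of_tendsto_eLpNorm (fun n ↦ (S n).memLp_integral hW t)
    (fun _ ↦ memLp_const (1 : ℝ)) hY2 (memLp_const (1 : ℝ)) hSY (by simp)
  simp only [mul_one, SimpleProcess.integral_integral_eq_zero _ hW] at h1
  exact tendsto_nhds_unique h1 tendsto_const_nhds

end Isometry

/-! ### Second moments of time integrals -/

section TimeIntegral

/-- Cauchy–Schwarz against the constant 1, obtained by expanding the integral of (T f - Y)² ≥ 0 and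
dividing by the total mass T when it is positive. -/
lemma sq_integral_le_measureReal_mul {α : Type*} {m : MeasurableSpace α} {μ : Measure α}
    [IsFiniteMeasure μ] {f : α → ℝ} (hf : MemLp f 2 μ) :
    (∫ x, f x ∂μ) ^ 2 ≤ μ.real Set.univ * ∫ x, f x ^ 2 ∂μ := by
  have hf1 := hf.integrable one_le_two
  have hf2 := hf.integrable_sq
  set T := μ.real Set.univ with hT
  set Y := ∫ x, f x ∂μ with hY
  rcases measureReal_nonneg (μ := μ) (s := Set.univ) |>.eq_or_lt with h0 | h0
  · have : μ = 0 := by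
      rwa [eq_comm, measureReal_eq_zero_iff, Measure.measure_univ_eq_zero] at h0
    simp [hY, this]
  · have h : 0 ≤ ∫ x, (T * f x - Y) ^ 2 ∂μ := integral_nonneg fun x ↦ sq_nonneg _
    have he : ∫ x, (T * f x - Y) ^ 2 ∂μ = T * (T * ∫ x, f x ^ 2 ∂μ - Y ^ 2) := by
      have h1 : ∀ x, (T * f x - Y) ^ 2 = T ^ 2 * f x ^ 2 - 2 * T * Y * f x + Y ^ 2 :=
        fun x ↦ by ring
      simp_rw [h1]
      have hi : Integrable (fun x ↦ T ^ 2 * f x ^ 2 - 2 * T * Y * f x) μ :=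
        (hf2.const_mul _).sub (hf1.const_mul _)
      rw [integral_add hi (integrable_const _), integral_sub (hf2.const_mul _) (hf1.const_mul _),
        integral_const_mul, integral_const_mul,
        integral_const, ← hY, ← hT, smul_eq_mul]
      ring
    rw [he] at h
    exact sub_nonneg.1 (nonneg_of_mul_nonneg_right h h0)

variable {α Ω : Type*} {mα : MeasurableSpace α} {mΩ : MeasurableSpace Ω} {μ : Measure α}
  {P : Measure Ω} {Z : α → Ω → ℝ}

/-- Integrating a square integrable process over a finite measure gives a square integrable
random variable. -/
lemma memLp_two_integral_of_prod [IsFiniteMeasure μ] [IsFiniteMeasure P]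
    (hZ : MemLp (fun p : α × Ω ↦ Z p.1 p.2) 2 (μ.prod P)) :
    MemLp (fun ω ↦ ∫ a, Z a ω ∂μ) 2 P := by
  have hm : AEStronglyMeasurable (fun ω ↦ ∫ a, Z a ω ∂μ) P :=
    hZ.aestronglyMeasurable.prod_swap.integral_prod_right'
  have hsq := hZ.integrable_sq
  rw [memLp_two_iff_integrable_sq hm]
  refine (hsq.integral_prod_right.const_mul (μ.real Set.univ)).mono' (hm.pow 2) ?_
  filter_upwards [hsq.prod_left_ae, hZ.aestronglyMeasurable.prod_swap.prodMk_left] with ω h1 h2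
  rw [Real.norm_of_nonneg (sq_nonneg _)]
  exact sq_integral_le_measureReal_mul ((memLp_two_iff_integrable_sq h2).2 h1)

lemma integral_mul_integral_of_prod [IsFiniteMeasure μ] [IsFiniteMeasure P]
    (hZ : MemLp (fun p : α × Ω ↦ Z p.1 p.2) 2 (μ.prod P)) {V : Ω → ℝ} (hV : MemLp V 2 P) :
    ∫ ω, V ω * ∫ a, Z a ω ∂μ ∂P = ∫ a, ∫ ω, V ω * Z a ω ∂P ∂μ := by
  have hi : Integrable (Function.uncurry fun a ω ↦ V ω * Z a ω) (μ.prod P) :=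
    (hV.comp_snd μ).integrable_mul hZ
  rw [integral_integral_swap hi]
  simp_rw [integral_const_mul]

/-- The second moment of a time integral is the double integral of the covariance kernel. -/
lemma integral_sq_integral_of_prod [IsFiniteMeasure μ] [IsFiniteMeasure P]
    (hZ : MemLp (fun p : α × Ω ↦ Z p.1 p.2) 2 (μ.prod P)) :
    ∫ ω, (∫ a, Z a ω ∂μ) ^ 2 ∂P = ∫ a, ∫ b, ∫ ω, Z a ω * Z b ω ∂P ∂μ ∂μ := by
  simp_rw [sq]
  -- Fubini is used twice: first with V the time integral itself, then with V the slice `Z a`, which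
  -- is in L² for almost every a.
  rw [integral_mul_integral_of_prod hZ (memLp_two_integral_of_prod hZ)]
  refine integral_congr_ae ?_
  filter_upwards [hZ.integrable_sq.prod_right_ae, hZ.aestronglyMeasurable.prodMk_left]
    with a h1 h2
  rw [← integral_mul_integral_of_prod hZ ((memLp_two_iff_integrable_sq h2).2 h1)]
  simp_rw [mul_comm]

end TimeIntegral

/-! ### Joint measurability from path continuity -/

section JointMeasurability

variable {Ω : Type*} {mΩ : MeasurableSpace Ω} {P : Measure Ω}

/-- A process with almost surely continuous paths is jointly measurable up to a null set. -/
lemma aestronglyMeasurable_uncurry_of_continuousOn [SFinite P] {T : ℝ≥0} {X : ℝ≥0 → Ω → ℝ}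
    (hm : ∀ t ≤ T, AEMeasurable (X t) P)
    (hc : ∀ᵐ ω ∂P, ContinuousOn (fun t ↦ X t ω) (Set.Icc 0 T)) :
    AEStronglyMeasurable (fun p : ℝ × Ω ↦ X p.1.toNNReal p.2)
      ((volume.restrict (Set.Ioc 0 (T : ℝ))).prod P) := by
  -- Each X(t) is only almost everywhere measurable, and only for t ≤ T; beyond T the version is an
  -- arbitrary 0.
  have hV : ∀ t, ∃ v : Ω → ℝ, Measurable v ∧ (t ≤ T → X t =ᵐ[P] v) := fun t ↦ by
    by_cases ht : t ≤ T
    · exact ⟨(hm t ht).mk, (hm t ht).measurable_mk, fun _ ↦ (hm t ht).ae_eq_mk⟩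
    · exact ⟨0, measurable_zero, fun h ↦ absurd h ht⟩
  choose V hVm hVX using hV
  -- Grid of mesh 1/n. It is countable, so one null set serves all grid points; for n = 0 every
  -- point is 0.
  let d : ℕ → ℕ → ℝ≥0 := fun n k ↦ k / n
  have hg (n : ℕ) : Measurable (fun p : ℝ × Ω ↦ V (d n ⌊p.1.toNNReal * n⌋₊) p.2) := by
    have h1 : Measurable (fun q : ℕ × Ω ↦ V (d n q.1) q.2) :=
      measurable_from_prod_countable_right fun k ↦ hVm (d n k)
    have h2 : Measurable (fun p : ℝ × Ω ↦ (⌊p.1.toNNReal * n⌋₊, p.2)) := by fun_prop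
    exact h1.comp h2
  have hae : ∀ᵐ ω ∂P, ContinuousOn (fun t ↦ X t ω) (Set.Icc 0 T) ∧
      ∀ n k, d n k ≤ T → X (d n k) ω = V (d n k) ω := by
    refine hc.and (ae_all_iff.2 fun n ↦ ae_all_iff.2 fun k ↦ ?_)
    by_cases hk : d n k ≤ T
    · filter_upwards [hVX _ hk] with ω hω _ using hω
    · exact Eventually.of_forall fun _ h ↦ absurd h hk
  refine (aemeasurable_of_tendsto_metrizable_ae atTop (fun n ↦ (hg n).aemeasurable)
    ?_).aestronglyMeasurable
  have hfst : ∀ᵐ p ∂((volume.restrict (Set.Ioc 0 (T : ℝ))).prod P), p.1 ∈ Set.Ioc 0 (T : ℝ) :=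
    Measure.quasiMeasurePreserving_fst.ae (ae_restrict_mem measurableSet_Ioc)
  filter_upwards [hfst, Measure.quasiMeasurePreserving_snd.ae hae] with p hp ⟨hcont, hpV⟩
  have ht : p.1.toNNReal ≤ T := Real.toNNReal_le_iff_le_coe.2 hp.2
  -- Rounding down keeps the grid point in [0,T], where the path is continuous and agrees with V.
  have hd (n : ℕ) : d n ⌊p.1.toNNReal * n⌋₊ ≤ p.1.toNNReal :=
    div_le_of_le_mul₀ zero_le zero_le (Nat.floor_le zero_le)
  simp_rw [← fun n ↦ hpV n _ ((hd n).trans ht)]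
  have hlim : Tendsto (fun n : ℕ ↦ d n ⌊p.1.toNNReal * n⌋₊) atTop (𝓝 p.1.toNNReal) := by
    rw [← NNReal.tendsto_coe]
    have := (tendsto_nat_floor_mul_div_atTop (R := ℝ) p.1.toNNReal.coe_nonneg).comp
      tendsto_natCast_atTop_atTop
    refine this.congr fun n ↦ ?_
    simp only [Function.comp_apply, d, NNReal.coe_div, NNReal.coe_natCast]
    congr 2
  exact (hcont _ ⟨zero_le, ht⟩).tendsto.comp (tendsto_nhdsWithin_iff.2
    ⟨hlim, Eventually.of_forall fun n ↦ ⟨zero_le, (hd n).trans ht⟩⟩)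

end JointMeasurability

/-! ### Covariance and square integrability of the Itô process -/

section ItoProcess

variable {Ω : Type*} {mΩ : MeasurableSpace Ω} {P : Measure Ω} {𝓕 : Filtration ℝ≥0 mΩ}
  {W : ℝ≥0 → Ω → ℝ} {T : ℝ≥0} {h : ℝ → ℝ} {X : ℝ≥0 → Ω → ℝ}

namespace IsItoProcess

lemma sub_start_ae_eq (hX : IsItoProcess W 𝓕 P T h X) (t : ℝ≥0) :
    (fun ω ↦ X t ω - X 0 ω) =ᵐ[P] X t := by
  filter_upwards [hX.start_zero] with ω hω
  rw [hω, sub_zero]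

lemma memLp (hX : IsItoProcess W 𝓕 P T h X) {t : ℝ≥0} (ht : t ≤ T) : MemLp (X t) 2 P :=
  (memLp_congr_ae (hX.sub_start_ae_eq t)).1 (hX.eq_integral t ht).2.1

lemma integral_eq_zero [IsFiniteMeasure P] (hW : IsBrownianMotion W 𝓕 P)
    (hX : IsItoProcess W 𝓕 P T h X) {t : ℝ≥0} (ht : t ≤ T) : ∫ ω, X t ω ∂P = 0 := by
  rw [← integral_congr_ae (hX.sub_start_ae_eq t)]
  exact (hX.eq_integral t ht).integral_eq_zero hW

lemma integral_mul [IsProbabilityMeasure P] (hW : IsBrownianMotion W 𝓕 P)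
    (hX : IsItoProcess W 𝓕 P T h X) {s t : ℝ≥0} (hs : s ≤ T) (ht : t ≤ T) :
    ∫ ω, X s ω * X t ω ∂P = ∫ u in (0 : ℝ)..(min s t : ℝ≥0), h u ^ 2 := by
  have he : ∫ ω, (X s ω - X 0 ω) * (X t ω - X 0 ω) ∂P = ∫ ω, X s ω * X t ω ∂P :=
    integral_congr_ae ((hX.sub_start_ae_eq s).mul (hX.sub_start_ae_eq t))
  rw [← he, intervalIntegral.integral_of_le (NNReal.coe_nonneg _)]
  refine ((hX.eq_integral s hs).integral_mul hW (hX.eq_integral t ht)).trans ?_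
  -- The integrand is deterministic, so integrating over Ω only contributes the total mass 1.
  rw [integral_fun_fst (fun u ↦ h u * h u)]
  simp [sq]

lemma continuousOn_toNNReal {f : ℝ≥0 → ℝ} (hf : ContinuousOn f (Set.Icc 0 T)) :
    ContinuousOn (fun t : ℝ ↦ f t.toNNReal) (Set.Icc 0 (T : ℝ)) :=
  hf.comp (by fun_prop) fun _ ht ↦ ⟨zero_le, Real.toNNReal_le_iff_le_coe.2 ht.2⟩

/-- By the isometry the second moment at time t is the integral of h² over [0,t], bounded uniformly
by the integral over [0,T]. -/
lemma memLp_prod [IsProbabilityMeasure P] (hW : IsBrownianMotion W 𝓕 P)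
    (hh : MemLp h 2 (volume.restrict (Set.Ioc 0 (T : ℝ))))
    (hX : IsItoProcess W 𝓕 P T h X) :
    MemLp (fun p : ℝ × Ω ↦ X p.1.toNNReal p.2) 2
      ((volume.restrict (Set.Ioc 0 (T : ℝ))).prod P) := by
  have hm := aestronglyMeasurable_uncurry_of_continuousOn
    (fun t ht ↦ (hX.memLp ht).aestronglyMeasurable.aemeasurable) hX.continuous_paths
  have hT : ∀ᵐ t ∂(volume.restrict (Set.Ioc 0 (T : ℝ))), t ∈ Set.Ioc 0 (T : ℝ) :=
    ae_restrict_mem measurableSet_Ioc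
  have hle {t : ℝ} (ht : t ∈ Set.Ioc 0 (T : ℝ)) : t.toNNReal ≤ T :=
    Real.toNNReal_le_iff_le_coe.2 ht.2
  have hm2 : AEStronglyMeasurable (fun p : ℝ × Ω ↦ X p.1.toNNReal p.2 ^ 2)
      ((volume.restrict (Set.Ioc 0 (T : ℝ))).prod P) := hm.pow 2
  rw [memLp_two_iff_integrable_sq hm, integrable_prod_iff hm2]
  refine ⟨?_, ?_⟩
  · filter_upwards [hT] with t ht using (hX.memLp (hle ht)).integrable_sq
  · refine Integrable.of_bound (C := ∫ u in (0 : ℝ)..T, h u ^ 2)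
      hm2.norm.integral_prod_right' ?_
    filter_upwards [hT] with t ht
    rw [Real.norm_of_nonneg (integral_nonneg fun _ ↦ norm_nonneg _)]
    simp_rw [Real.norm_of_nonneg (sq_nonneg _), sq (X _ _)]
    rw [hX.integral_mul hW (hle ht) (hle ht), min_self,
      intervalIntegral.integral_of_le (NNReal.coe_nonneg _),
      intervalIntegral.integral_of_le (NNReal.coe_nonneg _)]
    exact setIntegral_mono_set hh.integrable_sq (Eventually.of_forall fun _ ↦ sq_nonneg _)
      (Set.Ioc_subset_Ioc_right (NNReal.coe_le_coe.2 (hle ht))).eventuallyLE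

end IsItoProcess

end ItoProcess

/-- Splitting the inner integral of a function of the minimum at the diagonal. -/
lemma integral_integral_min {T : ℝ} (hT : 0 ≤ T) {g : ℝ → ℝ}
    (hg : ContinuousOn g (Set.Icc 0 T)) :
    ∫ s in (0 : ℝ)..T, ∫ t in (0 : ℝ)..T, g (min s t) =
      (∫ s in (0 : ℝ)..T, ∫ t in (0 : ℝ)..s, g t) + ∫ s in (0 : ℝ)..T, (T - s) * g s := by
  have hgi : IntegrableOn g (Set.Icc 0 T) := hg.integrableOn_Icc
  have h1 : IntervalIntegrable (fun s ↦ ∫ t in (0 : ℝ)..s, g t) volume 0 T := by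
    refine ContinuousOn.intervalIntegrable_of_Icc hT ?_
    have := intervalIntegral.continuousOn_primitive_interval (a := 0) (b := T) (f := g)
      (by rwa [Set.uIcc_of_le hT])
    rwa [Set.uIcc_of_le hT] at this
  have h2 : IntervalIntegrable (fun s ↦ (T - s) * g s) volume 0 T :=
    ContinuousOn.intervalIntegrable_of_Icc hT (by fun_prop)
  rw [← intervalIntegral.integral_add h1 h2]
  refine intervalIntegral.integral_congr fun s hs ↦ ?_
  rw [Set.uIcc_of_le hT] at hs
  have hc : ContinuousOn (fun t ↦ g (min s t)) (Set.Icc 0 T) :=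
    hg.comp (by fun_prop) fun t ht ↦ ⟨le_min hs.1 ht.1, (min_le_left _ _).trans hs.2⟩
  rw [← intervalIntegral.integral_add_adjacent_intervals (b := s)
    ((hc.mono (Set.Icc_subset_Icc_right hs.2)).intervalIntegrable_of_Icc hs.1)
    ((hc.mono (Set.Icc_subset_Icc_left hs.1)).intervalIntegrable_of_Icc hs.2)]
  congr 1
  · refine intervalIntegral.integral_congr fun t ht ↦ ?_
    rw [Set.uIcc_of_le hs.1] at ht
    simp [min_eq_right ht.2]
  · rw [intervalIntegral.integral_congr (g := fun _ ↦ g s) fun t ht ↦ by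
      rw [Set.uIcc_of_le hs.2] at ht
      simp [min_eq_left ht.1]]
    simp

end ItoVar

/-! ### Variance of the time integral -/

theorem mainTheorem4 {Ω : Type*} {mΩ : MeasurableSpace Ω} (P : Measure Ω) [IsProbabilityMeasure P]
    (𝓕 : Filtration ℝ≥0 mΩ) (W : ℝ≥0 → Ω → ℝ) (hW : ItoVar.IsBrownianMotion W 𝓕 P)
    (T : ℝ≥0) (h : ℝ → ℝ) (hh : MemLp h 2 (volume.restrict (Set.Ioc 0 (T : ℝ))))
    (X : ℝ≥0 → Ω → ℝ) (hX : ItoVar.IsItoProcess W 𝓕 P T h X) :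
    (∀ᵐ ω ∂P, IntervalIntegrable (fun t : ℝ ↦ X t.toNNReal ω) volume 0 T) ∧
    MemLp (fun ω ↦ ∫ t in (0 : ℝ)..T, X t.toNNReal ω) 2 P ∧
    Var[fun ω ↦ ∫ t in (0 : ℝ)..T, X t.toNNReal ω; P] =
      (∫ s in (0 : ℝ)..T, ∫ t in (0 : ℝ)..s, ∫ u in (0 : ℝ)..t, h u ^ 2) +
        ∫ s in (0 : ℝ)..T, (T - s) * ∫ t in (0 : ℝ)..s, h t ^ 2 := by
  have hT : (0 : ℝ) ≤ T := T.coe_nonneg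
  have hZ := hX.memLp_prod hW hh
  have hle {t : ℝ} (ht : t ∈ Set.Ioc 0 (T : ℝ)) : t.toNNReal ≤ T :=
    Real.toNNReal_le_iff_le_coe.2 ht.2
  have hY : MemLp (fun ω ↦ ∫ t in (0 : ℝ)..T, X t.toNNReal ω) 2 P := by
    simp_rw [intervalIntegral.integral_of_le hT]
    exact ItoVar.memLp_two_integral_of_prod (Z := fun (t : ℝ) ω ↦ X t.toNNReal ω) hZ
  have hmean : ∫ ω, (∫ t in (0 : ℝ)..T, X t.toNNReal ω) ∂P = 0 := by
    have := ItoVar.integral_mul_integral_of_prod (Z := fun (t : ℝ) ω ↦ X t.toNNReal ω) hZ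
      (memLp_const (1 : ℝ))
    simp only [one_mul] at this
    simp_rw [intervalIntegral.integral_of_le hT]
    rw [this, setIntegral_congr_fun measurableSet_Ioc
      fun t ht ↦ hX.integral_eq_zero hW (hle ht)]
    simp
  refine ⟨?_, hY, ?_⟩
  · filter_upwards [hX.continuous_paths] with ω hω
    exact (ItoVar.IsItoProcess.continuousOn_toNNReal hω).intervalIntegrable_of_Icc hT
  -- As a primitive of an integrable function, G is continuous, as `integral_integral_min` requires.
  · have hg : ContinuousOn (fun t : ℝ ↦ ∫ u in (0 : ℝ)..t, h u ^ 2) (Set.Icc 0 (T : ℝ)) := by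
      have := intervalIntegral.continuousOn_primitive_interval (μ := volume) (a := 0) (b := T)
        (f := fun u ↦ h u ^ 2) (by
          rw [Set.uIcc_of_le hT, integrableOn_Icc_iff_integrableOn_Ioc]
          exact hh.integrable_sq)
      rwa [Set.uIcc_of_le hT] at this
    rw [variance_of_integral_eq_zero hY.aestronglyMeasurable.aemeasurable hmean,
      ← ItoVar.integral_integral_min hT hg]
    simp_rw [intervalIntegral.integral_of_le hT]
    rw [ItoVar.integral_sq_integral_of_prod (Z := fun (t : ℝ) ω ↦ X t.toNNReal ω) hZ]
    refine setIntegral_congr_fun measurableSet_Ioc fun s hs ↦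
      setIntegral_congr_fun measurableSet_Ioc fun t ht ↦ ?_
    rw [hX.integral_mul hW (hle hs) (hle ht), NNReal.coe_min, Real.coe_toNNReal _ hs.1.le,
      Real.coe_toNNReal _ ht.1.le]
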